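/- All structures have a finite relational language and a universe contained in $\omega$; a class of structures has a single language and is closed under isomorphism (among such structures). The atomic diagram $D(\mathcal A)$ is the set of atomic sentences and negated atomic sentences about elements of $\mathcal A$ that are true in $\mathcal A$. A computable transformation from $K$ to $K'$ is a c.e. set $\Phi$ of pairs $(\alpha,\varphi)$, where $\alpha$ is a finite subset of the atomic diagram of a finite structure in the language of $K$ and $\varphi$ is an atomic or negated atomic sentence in the language of $K'$, such that for every $\mathcal A\in K$ the set $\{\varphi : (\alpha,\varphi)\in\Phi \text{ for some } \alpha\subseteq D(\mathcal A)\}$ is $D(\mathcal B)$ for some $\mathcal B\in K'$, denoted $\Phi(\mathcal A)$. Write $K\le_c K'$ if there is a computable transformation $\Phi$ from $K$ to $K'$ such that, for all $\mathcal A,\mathcal A'\in K$, $\mathcal A\cong\mathcal A'$ if and only if $\Phi(\mathcal A)\cong\Phi(\mathcal A')$; $K$ and $K'$ are incomparable, $K\perp K'$, if $K\not\le_c K'$ and $K'\not\le_c K$. Let $PF$, $FLO$ and $FVS$ be the classes of finite prime fields, finite linear orders, and finite dimensional $\mathbb Q$-vector spaces (as two-sorted structures with a sort of scalars and a sort of vectors),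 respectively. For $S\subseteq\omega$ let $K(S)$ be the class of finite dimensional $\mathbb Q$-vector spaces whose dimension lies in $S$. Sets $A,B\subseteq\omega$ are $\Delta^0_3$ bi-immune if for every $\Delta^0_3$ function $h:\omega\to\omega$ with infinite range there are $a\in A$ with $h(a)\notin B$ and $b\in B$ with $h(b)\notin A$. **Proposition.** There is a family $(A_f)_{f\in 2^\omega}$ of subsets of $\omega$ such that $A_f$ and $A_g$ are $\Delta^0_3$ bi-immune for all distinct $f,g\in 2^\omega$, and such that the classes $K_f=K(A_f)$ satisfy: for every $f\in 2^\omega$, $K_f\le_c FVS$, $K_f\perp PF$ and $K_f\perp FLO$; and for all distinct $f,g\in 2^\omega$, $K_f\perp K_g$. -/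

import Mathlib

open scoped FirstOrder

/-! ### Structures with universe a subset of `ℕ`, and their atomic diagrams -/

/-- An `L`-structure whose universe is a set of natural numbers. -/
structure NatStructure (L : FirstOrder.Language.{0, 0}) where
  dom : Set ℕ
  str : L.Structure dom

attribute [instance] NatStructure.str

/-- Isomorphism of structures. -/
def NatStructure.Iso {L : FirstOrder.Language.{0, 0}} (A B : NatStructure L) : Prop :=
  Nonempty (A.dom ≃[L] B.dom)

/-- Atomic sentences of a relational language expanded by names for the natural numbers:
`a = b` and `R(v₁, …, vₙ)`. -/
inductive AtomicSentence (L : FirstOrder.Language.{0, 0}) : Type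
  | eq (a b : ℕ) : AtomicSentence L
  | rel {n : ℕ} (R : L.Relations n) (v : Fin n → ℕ) : AtomicSentence L

/-- Atomic sentences (`pos`) and negations of atomic sentences (`neg`). -/
inductive Literal (L : FirstOrder.Language.{0, 0}) : Type
  | pos (φ : AtomicSentence L) : Literal L
  | neg (φ : AtomicSentence L) : Literal L

/-- All the numbers named in the sentence belong to the universe of `A`. -/
def AtomicSentence.NamesIn {L : FirstOrder.Language.{0, 0}} (A : NatStructure L) : AtomicSentence L → Prop
  | .eq a b => a ∈ A.dom ∧ b ∈ A.dom
  | .rel _ v => ∀ i, v i ∈ A.dom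

/-- The atomic sentence is about elements of `A` and true in `A`. -/
def AtomicSentence.HoldsIn {L : FirstOrder.Language.{0, 0}} (A : NatStructure L) : AtomicSentence L → Prop
  | .eq a b => a ∈ A.dom ∧ b ∈ A.dom ∧ a = b
  | .rel R v => ∃ h : ∀ i, v i ∈ A.dom, FirstOrder.Language.Structure.RelMap R fun i =>
      (⟨v i, h i⟩ : A.dom)

/-- The atomic diagram `D(A)`: the atomic sentences and negations of atomic sentences about elements
of `A` that are true in `A`. -/
def NatStructure.diagram {L : FirstOrder.Language.{0, 0}} (A : NatStructure L) : Set (Literal L) :=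
  {l | match l with
    | .pos φ => φ.HoldsIn A
    | .neg φ => φ.NamesIn A ∧ ¬ φ.HoldsIn A}

/-! ### Gödel numbers and computably enumerable sets of pairs -/

/-- Codes of literals: a sign, a symbol (`0` for equality, `k + 1` for the relation symbol with
number `k`), and the list of arguments. Such triples are identified with natural numbers by
the standard computable pairing. -/
abbrev LiteralCode : Type := Bool × ℕ × List ℕ

section coding

variable {L : FirstOrder.Language.{0, 0}} [Encodable (Σ n, L.Relations n)]

def AtomicSentence.code : AtomicSentence L → ℕ × List ℕ
  | .eq a b => (0, [a, b])
  | @AtomicSentence.rel _ n R v =>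
      (Encodable.encode (⟨n, R⟩ : Σ n, L.Relations n) + 1, List.ofFn v)

def Literal.code : Literal L → LiteralCode
  | .pos φ => (true, φ.code)
  | .neg φ => (false, φ.code)

end coding

/-- A set of pairs `(α, φ)`, with `α` a finite set of literals of `L` and `φ` a literal of `L'`, is
computably enumerable. Here a finite set is presented by any list of its elements. -/
def IsCE {L L' : FirstOrder.Language.{0, 0}} [Encodable (Σ n, L.Relations n)]
    [Encodable (Σ n, L'.Relations n)] (Φ : Set (Finset (Literal L) × Literal L')) : Prop :=
  REPred fun p : List LiteralCode × LiteralCode =>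
    ∃ α : Finset (Literal L), ∃ φ : Literal L', (α, φ) ∈ Φ ∧
      (∀ c, c ∈ p.1 ↔ ∃ l ∈ α, l.code = c) ∧ φ.code = p.2

/-- The enumeration operator given by `Φ`: `Φ(D) = {φ | ∃ α ⊆ D, (α, φ) ∈ Φ}`. -/
def enumOperator {L L' : FirstOrder.Language.{0, 0}} (Φ : Set (Finset (Literal L) × Literal L'))
    (D : Set (Literal L)) : Set (Literal L') :=
  {φ | ∃ α : Finset (Literal L), (α : Set (Literal L)) ⊆ D ∧ (α, φ) ∈ Φ}

/-! ### Classes of structures and computable embeddings -/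

/-- A class of structures: a finite relational language and a collection of structures for it, with
universes contained in `ℕ`, closed under isomorphism. The numbering `enc` of the finitely many
relation symbols serves only to define Gödel numbers. -/
structure StructureClass where
  L : FirstOrder.Language.{0, 0}
  relational : L.IsRelational
  finite : Finite (Σ n, L.Relations n)
  enc : Encodable (Σ n, L.Relations n)
  carrier : Set (NatStructure L)
  iso_closed : ∀ A B : NatStructure L, A.Iso B → A ∈ carrier → B ∈ carrier

attribute [instance] StructureClass.enc

namespace StructureClass

/-- `Φ` is a computable transformation from `K` to `K'`. -/
def IsCompTransformation (K K' : StructureClass)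
    (Φ : Set (Finset (Literal K.L) × Literal K'.L)) : Prop :=
  (∀ p ∈ Φ, ∃ A : NatStructure K.L, A.dom.Finite ∧ (p.1 : Set (Literal K.L)) ⊆ A.diagram) ∧
  IsCE Φ ∧
  ∀ A ∈ K.carrier, ∃ B ∈ K'.carrier, enumOperator Φ A.diagram = B.diagram

/-- `Φ` is a computable embedding of `K` in `K'`: a computable transformation that is well defined
and one-to-one on isomorphism types. -/
def IsCompEmbedding (K K' : StructureClass)
    (Φ : Set (Finset (Literal K.L) × Literal K'.L)) : Prop :=
  IsCompTransformation K K' Φ ∧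
  ∀ A ∈ K.carrier, ∀ A' ∈ K.carrier, ∀ B ∈ K'.carrier, ∀ B' ∈ K'.carrier,
    enumOperator Φ A.diagram = B.diagram → enumOperator Φ A'.diagram = B'.diagram →
      (A.Iso A' ↔ B.Iso B')

/-- `K ≤_c K'`. -/
def CompEmbeds (K K' : StructureClass) : Prop :=
  ∃ Φ : Set (Finset (Literal K.L) × Literal K'.L), IsCompEmbedding K K' Φ

/-- `K ⊥ K'`. -/
def Incomparable (K K' : StructureClass) : Prop :=
  ¬ CompEmbeds K K' ∧ ¬ CompEmbeds K' K

end StructureClass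

/-! ### The class `FLO` of finite linear orders -/

/-- Finite linear orders, in the language with one binary relation symbol `≤`. -/
def FLO : StructureClass where
  L := FirstOrder.Language.order
  relational := inferInstance
  finite := inferInstance
  enc := Encodable.ofEquiv Unit (Equiv.ofUnique _ _)
  carrier := {A | ∃ (M : Type) (_ : LinearOrder M),
    letI := FirstOrder.Language.orderStructure (M := M)
    Finite M ∧ Nonempty (A.dom ≃[FirstOrder.Language.order] M)}
  iso_closed := by
    rintro A B ⟨e⟩ ⟨M, i, hM, ⟨f⟩⟩
    let := FirstOrder.Language.orderStructure (M := M)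
    exact ⟨M, i, hM, ⟨f.comp e.symm⟩⟩

/-! ### The class `PF` of finite prime fields -/

/-- Symbols of the relational language of fields: the constants and the graphs of the
operations. -/
inductive FieldRel : ℕ → Type
  | zero : FieldRel 1
  | one : FieldRel 1
  | add : FieldRel 3
  | mul : FieldRel 3

/-- The relational language of fields. -/
def fieldLang : FirstOrder.Language.{0, 0} := ⟨fun _ => Empty, FieldRel⟩

/-- A field as a structure for the relational language. -/
@[reducible] def fieldStructure (F : Type) [Field F] : fieldLang.Structure F where
  funMap := fun f _ => f.elim
  RelMap := fun {_} R v =>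
    match R, v with
    | FieldRel.zero, v => v 0 = 0
    | FieldRel.one, v => v 0 = 1
    | FieldRel.add, v => v 0 + v 1 = v 2
    | FieldRel.mul, v => v 0 * v 1 = v 2

def FieldRel.equivFin : (Σ n, fieldLang.Relations n) ≃ Fin 4 where
  toFun
    | ⟨_, FieldRel.zero⟩ => 0
    | ⟨_, FieldRel.one⟩ => 1
    | ⟨_, FieldRel.add⟩ => 2
    | ⟨_, FieldRel.mul⟩ => 3
  invFun
    | 0 => ⟨1, FieldRel.zero⟩
    | 1 => ⟨1, FieldRel.one⟩
    | 2 => ⟨3, FieldRel.add⟩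
    | 3 => ⟨3, FieldRel.mul⟩
  left_inv := by rintro ⟨_, _ | _⟩ <;> rfl
  right_inv := by intro i; fin_cases i <;> rfl

/-- Finite prime fields, that is, the isomorphic copies of the fields `ℤ/pℤ`. -/
def PF : StructureClass where
  L := fieldLang
  relational := fun _ => inferInstanceAs (IsEmpty Empty)
  finite := Finite.of_equiv _ FieldRel.equivFin.symm
  enc := Encodable.ofEquiv _ FieldRel.equivFin
  carrier := {A | ∃ (p : ℕ) (_ : Fact p.Prime),
    letI := fieldStructure (ZMod p)
    Nonempty (A.dom ≃[fieldLang] ZMod p)}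
  iso_closed := by
    rintro A B ⟨e⟩ ⟨p, i, ⟨f⟩⟩
    let := fieldStructure (ZMod p)
    exact ⟨p, i, ⟨f.comp e.symm⟩⟩

/-! ### Classes of vector spaces over `ℚ` -/

/-- Symbols of the relational language of vector spaces: unary relations for the sort of scalars and
the sort of vectors, and the constants and the graphs of the operations. -/
inductive VectRel : ℕ → Type
  | vector : VectRel 1
  | scalar : VectRel 1
  | zeroF : VectRel 1
  | oneF : VectRel 1
  | addF : VectRel 3
  | mulF : VectRel 3
  | zeroV : VectRel 1
  | addV : VectRel 3
  | smulV : VectRel 3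

/-- The (two-sorted, finite, relational) language of vector spaces. -/
def vectLang : FirstOrder.Language.{0, 0} := ⟨fun _ => Empty, VectRel⟩

/-- A `ℚ`-vector space `W` as a structure: the universe is the disjoint union of the field `ℚ` of
scalars and the space `W` of vectors. -/
@[reducible] def vectStructure (W : Type) [AddCommGroup W] [Module ℚ W] :
    vectLang.Structure (ℚ ⊕ W) where
  funMap := fun f _ => f.elim
  RelMap := fun {_} R v =>
    match R, v with
    | VectRel.vector, v => ∃ x : W, v 0 = .inr x
    | VectRel.scalar, v => ∃ q : ℚ, v 0 = .inl q
    | VectRel.zeroF, v => v 0 = .inl 0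
    | VectRel.oneF, v => v 0 = .inl 1
    | VectRel.addF, v => ∃ q r : ℚ, v 0 = .inl q ∧ v 1 = .inl r ∧ v 2 = .inl (q + r)
    | VectRel.mulF, v => ∃ q r : ℚ, v 0 = .inl q ∧ v 1 = .inl r ∧ v 2 = .inl (q * r)
    | VectRel.zeroV, v => v 0 = .inr 0
    | VectRel.addV, v => ∃ x y : W, v 0 = .inr x ∧ v 1 = .inr y ∧ v 2 = .inr (x + y)
    | VectRel.smulV, v => ∃ (q : ℚ) (x : W), v 0 = .inl q ∧ v 1 = .inr x ∧ v 2 = .inr (q • x)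

def VectRel.equivFin : (Σ n, vectLang.Relations n) ≃ Fin 9 where
  toFun
    | ⟨_, VectRel.vector⟩ => 0
    | ⟨_, VectRel.scalar⟩ => 1
    | ⟨_, VectRel.zeroF⟩ => 2
    | ⟨_, VectRel.oneF⟩ => 3
    | ⟨_, VectRel.addF⟩ => 4
    | ⟨_, VectRel.mulF⟩ => 5
    | ⟨_, VectRel.zeroV⟩ => 6
    | ⟨_, VectRel.addV⟩ => 7
    | ⟨_, VectRel.smulV⟩ => 8
  invFun
    | 0 => ⟨1, VectRel.vector⟩
    | 1 => ⟨1, VectRel.scalar⟩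
    | 2 => ⟨1, VectRel.zeroF⟩
    | 3 => ⟨1, VectRel.oneF⟩
    | 4 => ⟨3, VectRel.addF⟩
    | 5 => ⟨3, VectRel.mulF⟩
    | 6 => ⟨1, VectRel.zeroV⟩
    | 7 => ⟨3, VectRel.addV⟩
    | 8 => ⟨3, VectRel.smulV⟩
  left_inv := by rintro ⟨_, _ | _⟩ <;> rfl
  right_inv := by intro i; fin_cases i <;> rfl

/-- The class of finite dimensional `ℚ`-vector spaces whose dimension lies in `S`. -/
def vectClass (S : Set ℕ) : StructureClass where
  L := vectLang
  relational := fun _ => inferInstanceAs (IsEmpty Empty)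
  finite := Finite.of_equiv _ VectRel.equivFin.symm
  enc := Encodable.ofEquiv _ VectRel.equivFin
  carrier := {A | ∃ (W : Type) (_ : AddCommGroup W) (_ : Module ℚ W),
    letI := vectStructure W
    FiniteDimensional ℚ W ∧ Module.finrank ℚ W ∈ S ∧
      Nonempty (A.dom ≃[vectLang] (ℚ ⊕ W))}
  iso_closed := by
    rintro A B ⟨e⟩ ⟨W, i, j, hW, hS, ⟨f⟩⟩
    let := vectStructure W
    exact ⟨W, i, j, hW, hS, ⟨f.comp e.symm⟩⟩

/-- The class of all finite dimensional `ℚ`-vector spaces. -/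
def FVS : StructureClass := vectClass Set.univ

/-! ### `Δ⁰₃` functions and bi-immunity -/

/-- `P` is `Σ⁰₃`. -/
def IsSigma03 {α : Type} [Primcodable α] (P : α → Prop) : Prop :=
  ∃ R : α × ℕ × ℕ × ℕ → Prop, ComputablePred R ∧ ∀ a, P a ↔ ∃ x, ∀ y, ∃ z, R (a, x, y, z)

/-- `P` is `Π⁰₃`. -/
def IsPi03 {α : Type} [Primcodable α] (P : α → Prop) : Prop :=
  ∃ R : α × ℕ × ℕ × ℕ → Prop, ComputablePred R ∧ ∀ a, P a ↔ ∀ x, ∃ y, ∀ z, R (a, x, y, z)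

/-- The total function `f` is `Δ⁰₃` (equivalently, computable from the second jump of the empty
set): its graph is both `Σ⁰₃` and `Π⁰₃`. -/
def IsDelta03Fun (f : ℕ → ℕ) : Prop :=
  IsSigma03 (fun p : ℕ × ℕ => f p.1 = p.2) ∧ IsPi03 (fun p : ℕ × ℕ => f p.1 = p.2)

/-- `A` and `B` are `Δ⁰₃` bi-immune: every `Δ⁰₃` function with infinite range fails to map `A` into
`B` and fails to map `B` into `A`. -/
def Delta03BiImmune (A B : Set ℕ) : Prop :=
  ∀ f : ℕ → ℕ, IsDelta03Fun f → (Set.range f).Infinite →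
    (∃ a ∈ A, f a ∉ B) ∧ (∃ b ∈ B, f b ∉ A)

/-! ### Countability of the arithmetical notions -/

/-! Two independent obstructions carry the proof. The first is counting. There are only countably
many c.e. operators and `Δ⁰₃` functions, so one diagonal construction defeats them all
(`exists_family_avoiding`). An operator embedding a class with pairwise non-isomorphic members `X
j`, `j ∈ J`, in `K(S)` yields a function `j ↦ dim Φ(X j)` that is injective on `J` and has values in
`S` there. Putting these functions into the same countable family as the `Δ⁰₃` ones rules out
embeddings between distinct `K_f`, and from `PF` or `FLO` into `K_f` (`not_compEmbeds_vectClass`).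
Thus no bound on the arithmetical complexity of the dimension functions is needed.

The second obstruction is finiteness of information. A finite output structure is produced by a
finite part of the input diagram. Any finite piece of a `ℚ`-vector space embeds in every nonzero one
(`nonempty_vectLang_embedding`), so the images of two nonzero spaces would have equal cardinality
and hence be isomorphic in `PF` or `FLO` (`CompEmbeds.iso_of_locallyIn`). The positive statement
`K_f ≤_c FVS` is witnessed by the identity operator. -/

theorem countable_setOf_rePred (α : Type) [Primcodable α] :
    {p : α → Prop | REPred p}.Countable := by
  refine (Set.countable_range fun (c : Nat.Partrec.Code) (a : α) =>
    (c.eval (Encodable.encode a)).Dom).mono ?_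
  intro p hp
  obtain ⟨c, hc⟩ := Nat.Partrec.Code.exists_code.1 hp
  refine ⟨c, funext fun a => propext ?_⟩
  simp [hc, Part.assert, Encodable.encodek]

theorem countable_setOf_isDelta03Fun : {f : ℕ → ℕ | IsDelta03Fun f}.Countable := by
  have hR : {R : (ℕ × ℕ) × ℕ × ℕ × ℕ → Prop | ComputablePred R}.Countable :=
    (countable_setOf_rePred _).mono fun _ h => ComputablePred.to_re h
  have hP : {P : ℕ × ℕ → Prop | IsSigma03 P}.Countable := by
    refine (hR.image fun R p => ∃ x, ∀ y, ∃ z, R (p, x, y, z)).mono ?_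
    rintro P ⟨R, hR, h⟩
    exact ⟨R, hR, funext fun a => propext (h a).symm⟩
  refine Set.MapsTo.countable_of_injOn (f := fun f : ℕ → ℕ => fun p : ℕ × ℕ => f p.1 = p.2)
    (fun f hf => hf.1) ?_ hP
  intro f _ g _ h
  funext n
  have := congrFun h (n, g n)
  simpa using this

section coding

variable {L : FirstOrder.Language.{0, 0}} [Encodable (Σ n, L.Relations n)]

theorem AtomicSentence.code_injective : Function.Injective (AtomicSentence.code (L := L)) := by
  rintro (⟨a, b⟩ | ⟨R, v⟩) (⟨a', b'⟩ | ⟨R', v'⟩) h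
  · simp only [AtomicSentence.code, Prod.mk.injEq, List.cons.injEq] at h
    rw [h.2.1, h.2.2.1]
  · simp [AtomicSentence.code] at h
  · simp [AtomicSentence.code] at h
  · simp only [AtomicSentence.code, Prod.mk.injEq, Nat.add_right_cancel_iff,
      Encodable.encode_inj] at h
    obtain ⟨h₁, h₂⟩ := h
    cases h₁
    rw [List.ofFn_injective h₂]

theorem Literal.code_injective : Function.Injective (Literal.code (L := L)) := by
  rintro (φ | φ) (ψ | ψ) h <;> simp only [Literal.code, Prod.mk.injEq] at h
  · rw [AtomicSentence.code_injective h.2]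
  · simp at h
  · simp at h
  · rw [AtomicSentence.code_injective h.2]

end coding

/-- The c.e. predicate on codes determines `Φ`: literals have injective codes, and every pair of `Φ`
is presented by some list. -/
theorem countable_setOf_isCE (L L' : FirstOrder.Language.{0, 0})
    [Encodable (Σ n, L.Relations n)] [Encodable (Σ n, L'.Relations n)] :
    {Φ : Set (Finset (Literal L) × Literal L') | IsCE Φ}.Countable := by
  classical
  refine Set.MapsTo.countable_of_injOn
    (f := fun Φ : Set (Finset (Literal L) × Literal L') =>
      fun p : List LiteralCode × LiteralCode =>
        ∃ α : Finset (Literal L), ∃ φ : Literal L', (α, φ) ∈ Φ ∧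
          (∀ c, c ∈ p.1 ↔ ∃ l ∈ α, l.code = c) ∧ φ.code = p.2)
    (t := {p | REPred p}) (fun Φ h => h) ?_ (countable_setOf_rePred _)
  have key : ∀ Φ Ψ : Set (Finset (Literal L) × Literal L'),
      (∀ p : List LiteralCode × LiteralCode,
        (∃ α : Finset (Literal L), ∃ φ : Literal L', (α, φ) ∈ Φ ∧
          (∀ c, c ∈ p.1 ↔ ∃ l ∈ α, l.code = c) ∧ φ.code = p.2) →
        ∃ α : Finset (Literal L), ∃ φ : Literal L', (α, φ) ∈ Ψ ∧
          (∀ c, c ∈ p.1 ↔ ∃ l ∈ α, l.code = c) ∧ φ.code = p.2) → Φ ⊆ Ψ := by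
    rintro Φ Ψ h ⟨α, φ⟩ hΦ
    obtain ⟨β, ψ, hΨ, hβ, hψ⟩ := h ((α.image Literal.code).toList, φ.code)
      ⟨α, φ, hΦ, by simp, rfl⟩
    have hφ : ψ = φ := Literal.code_injective hψ
    have hα : β = α := by
      apply Finset.image_injective Literal.code_injective
      ext c
      simpa using (hβ c).symm
    rwa [← hφ, ← hα]
  intro Φ _ Ψ _ h
  exact (key Φ Ψ fun p hp => (congrFun h p).mp hp).antisymm
    (key Ψ Φ fun p hp => (congrFun h p).mpr hp)

/-! ### A continuum of sets avoiding countably many functions -/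

/-- Choose the points so sparse that `a e` and `F e (a e)` both lie above every earlier point and
every earlier value. The exception `e' = e` is unavoidable, since `F e` may be the identity. -/
theorem exists_injective_apply_eq_imp (F : ℕ → ℕ → ℕ) (hF : ∀ e, (Set.range (F e)).Infinite) :
    ∃ a : ℕ → ℕ, Function.Injective a ∧ ∀ e e', F e (a e) = a e' → e' = e := by
  have hx : ∀ e N, ∃ x, N ≤ x ∧ N ≤ F e x := by
    intro e N
    by_contra! h
    -- Otherwise every value is below `N` or is taken at an argument below `N`, so the range is
    -- finite.
    refine hF e (((Set.finite_Iio N).union ((Set.finite_Iio N).image (F e))).subset ?_)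
    rintro _ ⟨x, rfl⟩
    rcases lt_or_ge x N with hx | hx
    · exact Or.inr ⟨x, hx, rfl⟩
    · exact Or.inl (h x hx)
  choose c hc₁ hc₂ using hx
  -- `b e` is a threshold strictly above all points and values chosen at stages before `e`.
  let b : ℕ → ℕ := fun n => Nat.rec 0 (fun e N => max (c e N) (F e (c e N)) + 1) n
  have hb : ∀ e, b (e + 1) = max (c e (b e)) (F e (c e (b e))) + 1 := fun e => rfl
  have hmono : Monotone b := monotone_nat_of_le_succ fun e => by
    have := hc₁ e (b e); rw [hb]; omega
  have hlt : ∀ e e', e < e' → c e (b e) < c e' (b e') ∧ F e (c e (b e)) < c e' (b e') ∧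
      c e (b e) < F e' (c e' (b e')) := by
    intro e e' h
    have h₁ := hmono (Nat.succ_le_of_lt h)
    have h₂ := hc₁ e' (b e')
    have h₃ := hc₂ e' (b e')
    rw [Nat.succ_eq_add_one, hb] at h₁
    omega
  refine ⟨fun e => c e (b e), ?_, ?_⟩
  · intro e e' h
    rcases lt_trichotomy e e' with hl | hl | hl
    · exact absurd h (hlt _ _ hl).1.ne
    · exact hl
    · exact absurd h (hlt _ _ hl).1.ne'
  · intro e e' h
    rcases lt_trichotomy e e' with hl | hl | hl
    · exact absurd h (hlt _ _ hl).2.1.ne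
    · exact hl.symm
    · exact absurd h (hlt _ _ hl).2.2.ne'

/-- Each requirement `(n, b, i)` gets its own point, which enters `A f` exactly when `f n = b`. If
`f` and `g` differ at `n`, the point of `(n, f n, i)` is in `A f` but not in `A g`, and `u i` sends
it either to itself or to no chosen point at all. -/
theorem exists_family_avoiding (H : Set (ℕ → ℕ)) (hH : H.Countable) :
    ∃ A : (ℕ → Bool) → Set ℕ, (∀ f, (A f).Infinite) ∧
      ∀ f g, f ≠ g → ∀ h ∈ H, (Set.range h).Infinite → ∃ a ∈ A f, h a ∉ A g := by
  -- Adding `id` makes the set nonempty, so that it has an enumeration.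
  let H' : Set (ℕ → ℕ) := insert id {h ∈ H | (Set.range h).Infinite}
  have hH' : H'.Countable := (hH.mono fun _ h => h.1).insert _
  obtain ⟨u, hu⟩ := hH'.exists_eq_range ⟨id, Set.mem_insert _ _⟩
  have hinf : ∀ i, (Set.range (u i)).Infinite := by
    intro i
    have : u i ∈ H' := hu ▸ Set.mem_range_self i
    rcases this with h | h
    · rw [h, Set.range_id]; exact Set.infinite_univ
    · exact h.2
  obtain ⟨d⟩ : Nonempty (ℕ ≃ ℕ × Bool × ℕ) := nonempty_equiv_of_countable
  obtain ⟨a, ha, ha'⟩ := exists_injective_apply_eq_imp (fun e => u (d e).2.2) fun e => hinf _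
  refine ⟨fun f => {x | ∃ e, a e = x ∧ f (d e).1 = (d e).2.1}, ?_, ?_⟩
  · intro f
    refine Set.infinite_of_injective_forall_mem (f := fun n => a (d.symm (n, f n, 0))) ?_ ?_
    · intro m n h
      have := d.symm.injective (ha h)
      exact congrArg Prod.fst this
    · intro n
      exact ⟨_, rfl, by simp⟩
  · intro f g hfg h hh hr
    obtain ⟨n, hn⟩ := Function.ne_iff.1 hfg
    obtain ⟨i, rfl⟩ : h ∈ Set.range u := hu ▸ Set.mem_insert_of_mem _ ⟨hh, hr⟩
    have key := ha' (d.symm (n, f n, i))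
    refine ⟨a (d.symm (n, f n, i)), ⟨_, rfl, by simp⟩, ?_⟩
    rintro ⟨e', he', hg⟩
    have : e' = d.symm (n, f n, i) := key e' (by simpa using he'.symm)
    subst this
    simp at hg
    exact hn hg.symm

/-! ### Substructures, copies and diagrams -/

section structures

open FirstOrder.Language.Structure

variable {L : FirstOrder.Language.{0, 0}}

theorem NatStructure.Iso.refl (A : NatStructure L) : A.Iso A :=
  ⟨FirstOrder.Language.Equiv.refl L A.dom⟩

theorem NatStructure.Iso.symm {A B : NatStructure L} : A.Iso B → B.Iso A :=
  fun ⟨e⟩ => ⟨e.symm⟩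

theorem NatStructure.Iso.trans {A B C : NatStructure L} : A.Iso B → B.Iso C → A.Iso C :=
  fun ⟨e⟩ ⟨f⟩ => ⟨f.comp e⟩

theorem NatStructure.Iso.ncard_dom_eq {A B : NatStructure L} :
    A.Iso B → A.dom.ncard = B.dom.ncard :=
  fun ⟨e⟩ => Set.ncard_congr' e.toEquiv

theorem NatStructure.mem_dom_iff (A : NatStructure L) (a : ℕ) :
    a ∈ A.dom ↔ Literal.pos (.eq a a) ∈ A.diagram := by
  simp [NatStructure.diagram, AtomicSentence.HoldsIn]

theorem NatStructure.dom_subset_of_diagram_subset {A B : NatStructure L}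
    (h : A.diagram ⊆ B.diagram) : A.dom ⊆ B.dom := fun a ha =>
  (B.mem_dom_iff a).2 (h ((A.mem_dom_iff a).1 ha))

theorem NatStructure.iso_of_diagram_eq [L.IsRelational] {A B : NatStructure L}
    (h : A.diagram = B.diagram) : A.Iso B := by
  have hd : A.dom = B.dom := (dom_subset_of_diagram_subset h.subset).antisymm
    (dom_subset_of_diagram_subset h.superset)
  obtain ⟨dA, sA⟩ := A
  obtain ⟨dB, sB⟩ := B
  obtain rfl : dA = dB := hd
  refine ⟨@FirstOrder.Language.Equiv.mk L dA dA sA sB (Equiv.refl _) (fun f => isEmptyElim f) ?_⟩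
  intro n R v
  have := Set.ext_iff.1 h (.pos (.rel R fun i => (v i : ℕ)))
  simp only [NatStructure.diagram, AtomicSentence.HoldsIn, Set.mem_ofPred_eq, Subtype.coe_prop,
    implies_true, exists_true_left, Subtype.coe_eta] at this
  exact this.symm

/-- The substructure of `A` on the elements of `A` that lie in `F`. -/
def NatStructure.restrict [L.IsRelational] (A : NatStructure L) (F : Set ℕ) : NatStructure L where
  dom := A.dom ∩ F
  str :=
    { funMap := fun f _ => isEmptyElim f
      RelMap := fun R v => RelMap R fun i => (⟨v i, (v i).2.1⟩ : A.dom) }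

/-- The inclusion of a substructure. -/
def NatStructure.restrictEmbedding [L.IsRelational] (A : NatStructure L) (F : Set ℕ) :
    (A.restrict F).dom ↪[L] A.dom where
  toFun x := ⟨x, x.2.1⟩
  inj' _ _ h := Subtype.ext (Subtype.mk.inj h)
  map_fun' f := isEmptyElim f
  map_rel' _ _ := Iff.rfl

theorem NatStructure.diagram_subset_of_embedding {A B : NatStructure L}
    (e : A.dom ↪[L] B.dom) (he : ∀ x, (e x : ℕ) = x) : A.diagram ⊆ B.diagram := by
  have hsub : ∀ a, a ∈ A.dom → a ∈ B.dom := fun a ha => by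
    simpa [he] using (e ⟨a, ha⟩).2
  have hholds : ∀ φ : AtomicSentence L, φ.NamesIn A → (φ.HoldsIn A ↔ φ.HoldsIn B) := by
    rintro (⟨a, b⟩ | ⟨R, v⟩) hn
    · simp only [AtomicSentence.NamesIn] at hn
      simp [AtomicSentence.HoldsIn, hn, hsub]
    · simp only [AtomicSentence.NamesIn] at hn
      have hv : ∀ i, v i ∈ B.dom := fun i => hsub _ (hn i)
      have : (fun i => (⟨v i, hv i⟩ : B.dom)) = e ∘ fun i => (⟨v i, hn i⟩ : A.dom) := by
        funext i
        exact Subtype.ext (by simp [he])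
      simp only [AtomicSentence.HoldsIn, hn, hv, implies_true, exists_true_left, this]
      exact (e.map_rel R _).symm
  have hnames : ∀ φ : AtomicSentence L, φ.NamesIn A → φ.NamesIn B := by
    rintro (⟨a, b⟩ | ⟨R, v⟩) hn
    · exact ⟨hsub _ hn.1, hsub _ hn.2⟩
    · exact fun i => hsub _ (hn i)
  rintro (φ | φ) h
  · have hn : φ.NamesIn A := by
      rcases φ with ⟨a, b⟩ | ⟨R, v⟩
      · exact ⟨h.1, h.2.1⟩
      · exact h.1
    exact (hholds φ hn).1 h
  · exact ⟨hnames φ h.1, fun hB => h.2 ((hholds φ h.1).2 hB)⟩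

/-- The numbers named in an atomic sentence. -/
def AtomicSentence.names : AtomicSentence L → Set ℕ
  | .eq a b => {a, b}
  | .rel _ v => Set.range v

/-- The numbers named in a literal. -/
def Literal.names : Literal L → Set ℕ
  | .pos φ => φ.names
  | .neg φ => φ.names

theorem Literal.finite_names (l : Literal L) : l.names.Finite := by
  rcases l with (⟨a, b⟩ | ⟨R, v⟩) | (⟨a, b⟩ | ⟨R, v⟩)
  · exact Set.toFinite {a, b}
  · exact Set.finite_range v
  · exact Set.toFinite {a, b}
  · exact Set.finite_range v

theorem NatStructure.mem_diagram_restrict [L.IsRelational] (A : NatStructure L) {F : Set ℕ}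
    {l : Literal L} (hl : l ∈ A.diagram) (hF : l.names ⊆ F) : l ∈ (A.restrict F).diagram := by
  rcases l with (⟨a, b⟩ | ⟨R, v⟩) | (⟨a, b⟩ | ⟨R, v⟩)
  · exact ⟨⟨hl.1, hF (by simp [Literal.names, AtomicSentence.names])⟩,
      ⟨hl.2.1, hF (by simp [Literal.names, AtomicSentence.names])⟩, hl.2.2⟩
  · exact ⟨fun i => ⟨hl.1 i, hF ⟨i, rfl⟩⟩, hl.2⟩
  · exact ⟨⟨⟨hl.1.1, hF (by simp [Literal.names, AtomicSentence.names])⟩,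
      ⟨hl.1.2, hF (by simp [Literal.names, AtomicSentence.names])⟩⟩,
      fun h => hl.2 ⟨h.1.1, h.2.1.1, h.2.2⟩⟩
  · exact ⟨fun i => ⟨hl.1 i, hF ⟨i, rfl⟩⟩, fun h => hl.2 ⟨hl.1, h.2⟩⟩

theorem NatStructure.exists_finite_subset_diagram_restrict [L.IsRelational] (A : NatStructure L)
    {α : Set (Literal L)} (hα : α.Finite) (h : α ⊆ A.diagram) :
    ∃ F : Set ℕ, F.Finite ∧ α ⊆ (A.restrict F).diagram :=
  ⟨⋃ l ∈ α, l.names, hα.biUnion fun l _ => l.finite_names, fun _ hl =>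
    A.mem_diagram_restrict (h hl) (Set.subset_biUnion_of_mem hl)⟩

theorem exists_natStructure {M : Type} [L.Structure M] (ψ : M → ℕ) (hψ : ψ.Injective) :
    ∃ (A : NatStructure L) (e : M ≃[L] A.dom), ∀ x, (e x : ℕ) = ψ x := by
  let e := Equiv.ofInjective ψ hψ
  let := e.inducedStructure (L := L)
  exact ⟨⟨Set.range ψ, this⟩, e.inducedStructureEquiv, fun x => rfl⟩

/-- Name each point of the range of `f` by its preimage and all others by fresh numbers above
`C.dom`. The abstract embedding becomes an inclusion of diagrams. -/
theorem NatStructure.exists_diagram_subset_of_embedding {M : Type} [L.Structure M] [Countable M]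
    (C : NatStructure L) (hC : C.dom.Finite) (f : C.dom ↪[L] M) :
    ∃ B : NatStructure L, Nonempty (B.dom ≃[L] M) ∧ C.diagram ⊆ B.diagram := by
  classical
  obtain ⟨N, hN⟩ := hC.bddAbove
  obtain ⟨c, hc⟩ := Countable.exists_injective_nat M
  let ψ : M → ℕ := fun x => if h : ∃ a, f a = x then h.choose else N + 1 + c x
  have hf : ∀ a, ψ (f a) = a := fun a => by
    have h : ∃ a', f a' = f a := ⟨a, rfl⟩
    simp only [ψ, dif_pos h]
    rw [f.injective h.choose_spec]
  have hn : ∀ x, (¬ ∃ a, f a = x) → ψ x = N + 1 + c x := fun x h => dif_neg h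
  have hψ : ψ.Injective := by
    intro x y h
    by_cases hx : ∃ a, f a = x <;> by_cases hy : ∃ a, f a = y
    · obtain ⟨a, rfl⟩ := hx
      obtain ⟨b, rfl⟩ := hy
      rw [hf, hf] at h
      rw [Subtype.ext h]
    · obtain ⟨a, rfl⟩ := hx
      rw [hf, hn y hy] at h
      have := hN a.2
      omega
    · obtain ⟨b, rfl⟩ := hy
      rw [hf, hn x hx] at h
      have := hN b.2
      omega
    · rw [hn x hx, hn y hy] at h
      exact hc (by omega)
  obtain ⟨B, e, he⟩ := exists_natStructure (L := L) ψ hψ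
  refine ⟨B, ⟨e.symm⟩, NatStructure.diagram_subset_of_embedding (e.toEmbedding.comp f) ?_⟩
  intro x
  exact (he _).trans (hf x)

end structures

/-! ### Embeddings in classes of finite structures -/

theorem enumOperator_mono {L L' : FirstOrder.Language.{0, 0}}
    (Φ : Set (Finset (Literal L) × Literal L')) {D D' : Set (Literal L)} (h : D ⊆ D') :
    enumOperator Φ D ⊆ enumOperator Φ D' :=
  fun _ ⟨α, hα, hΦ⟩ => ⟨α, hα.trans h, hΦ⟩

/-- Continuity of enumeration operators: each output literal needs one finite `α`. -/
theorem exists_finite_subset_enumOperator {L L' : FirstOrder.Language.{0, 0}}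
    (Φ : Set (Finset (Literal L) × Literal L')) (D : Set (Literal L)) {S : Set (Literal L')}
    (hS : S.Finite) (h : S ⊆ enumOperator Φ D) :
    ∃ α : Set (Literal L), α.Finite ∧ α ⊆ D ∧ S ⊆ enumOperator Φ α := by
  have h' : ∀ φ ∈ S, ∃ α : Finset (Literal L), (α : Set (Literal L)) ⊆ D ∧ (α, φ) ∈ Φ :=
    fun φ hφ => h hφ
  choose! β hβ hΦ using h'
  exact ⟨⋃ φ ∈ S, (β φ : Set (Literal L)), hS.biUnion fun φ _ => (β φ).finite_toSet,
    Set.iUnion₂_subset fun φ hφ => hβ φ hφ,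
    fun φ hφ => ⟨β φ, Set.subset_biUnion_of_mem (u := fun φ => (β φ : Set (Literal L))) hφ,
      hΦ φ hφ⟩⟩

namespace StructureClass

/-- Every finite substructure of `A` is a substructure of a copy of `A'`. -/
def LocallyIn {L : FirstOrder.Language.{0, 0}} [L.IsRelational] (A A' : NatStructure L) : Prop :=
  ∀ F : Set ℕ, F.Finite → ∃ B : NatStructure L, B.Iso A' ∧ (A.restrict F).diagram ⊆ B.diagram

/-- The sentences `a = a` for `a ∈ B.dom` are enumerated from a finite piece of `A`. That piece lies
in a copy of `A'`, whose image is isomorphic to `B'` and, by monotonicity, contains `B.dom`. -/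
theorem IsCompEmbedding.ncard_dom_le {K K' : StructureClass}
    {Φ : Set (Finset (Literal K.L) × Literal K'.L)} (hΦ : IsCompEmbedding K K' Φ)
    (hfin : ∀ B ∈ K'.carrier, B.dom.Finite) [K.L.IsRelational] {A A' : NatStructure K.L}
    (hA' : A' ∈ K.carrier) {B B' : NatStructure K'.L} (hB : B ∈ K'.carrier)
    (hB' : B' ∈ K'.carrier) (hAB : enumOperator Φ A.diagram = B.diagram)
    (hAB' : enumOperator Φ A'.diagram = B'.diagram) (h : LocallyIn A A') :
    B.dom.ncard ≤ B'.dom.ncard := by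
  obtain ⟨α, hα, hαA, hS⟩ := exists_finite_subset_enumOperator Φ A.diagram
    (S := (fun a => Literal.pos (.eq a a)) '' B.dom) ((hfin B hB).image _) (by
      rintro _ ⟨a, ha, rfl⟩
      rw [hAB]
      exact (B.mem_dom_iff a).1 ha)
  obtain ⟨F, hF, hαF⟩ := A.exists_finite_subset_diagram_restrict hα hαA
  obtain ⟨C, hCA', hFC⟩ := h F hF
  have hC : C ∈ K.carrier := K.iso_closed _ _ hCA'.symm hA'
  obtain ⟨D, hD, hCD⟩ := hΦ.1.2.2 C hC
  have hiso : D.Iso B' := (hΦ.2 C hC A' hA' D hD B' hB' hCD hAB').1 hCA'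
  rw [← hiso.ncard_dom_eq]
  refine Set.ncard_le_ncard (fun a ha => ?_) (hfin D hD)
  rw [D.mem_dom_iff, ← hCD]
  exact enumOperator_mono Φ (hαF.trans hFC) (hS ⟨a, ha, rfl⟩)

/-- A computable embedding in a class whose structures are finite and determined by their
cardinality identifies structures with the same finite substructures. -/
theorem CompEmbeds.iso_of_locallyIn {K K' : StructureClass} (hKK' : K.CompEmbeds K')
    (hfin : ∀ B ∈ K'.carrier, B.dom.Finite)
    (hcard : ∀ B ∈ K'.carrier, ∀ B' ∈ K'.carrier, B.dom.ncard = B'.dom.ncard → B.Iso B')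
    [K.L.IsRelational] {A A' : NatStructure K.L} (hA : A ∈ K.carrier) (hA' : A' ∈ K.carrier)
    (h : LocallyIn A A') (h' : LocallyIn A' A) : A.Iso A' := by
  obtain ⟨Φ, hΦ⟩ := hKK'
  obtain ⟨B, hB, hAB⟩ := hΦ.1.2.2 A hA
  obtain ⟨B', hB', hAB'⟩ := hΦ.1.2.2 A' hA'
  refine (hΦ.2 A hA A' hA' B hB B' hB' hAB hAB').2 (hcard B hB B' hB' (le_antisymm ?_ ?_))
  · exact hΦ.ncard_dom_le hfin hA' hB hB' hAB hAB' h
  · exact hΦ.ncard_dom_le hfin hA hB' hB hAB' hAB h'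

end StructureClass

/-! ### The identity as a computable embedding -/

section coding

open FirstOrder.Language.Structure

/-- The literal does not contradict the logic of equality. -/
def Literal.Consistent {L : FirstOrder.Language.{0, 0}} : Literal L → Prop
  | .pos (.eq a b) => a = b
  | .neg (.eq a b) => a ≠ b
  | .pos (.rel _ _) => True
  | .neg (.rel _ _) => True

theorem Literal.consistent_of_mem_diagram {L : FirstOrder.Language.{0, 0}} {A : NatStructure L}
    {l : Literal L} (h : l ∈ A.diagram) : l.Consistent := by
  rcases l with (⟨a, b⟩ | ⟨R, v⟩) | (⟨a, b⟩ | ⟨R, v⟩)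
  · exact h.2.2
  · trivial
  · exact fun hab => h.2 ⟨h.1.1, h.1.2, hab⟩
  · trivial

/-- Take the named elements as universe and let all relations be full, or all empty for a negated
relation. -/
theorem Literal.Consistent.exists_finite {L : FirstOrder.Language.{0, 0}} [L.IsRelational]
    {l : Literal L} (h : l.Consistent) :
    ∃ A : NatStructure L, A.dom.Finite ∧ l ∈ A.diagram := by
  let M (P : Prop) : NatStructure L :=
    ⟨l.names, { funMap := fun f _ => isEmptyElim f, RelMap := fun _ _ => P }⟩
  have hM : ∀ P, (M P).dom.Finite := fun _ => l.finite_names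
  rcases l with (⟨a, b⟩ | ⟨R, v⟩) | (⟨a, b⟩ | ⟨R, v⟩)
  · exact ⟨M True, hM _, .inl rfl, .inr rfl, h⟩
  · exact ⟨M True, hM _, fun i => ⟨i, rfl⟩, trivial⟩
  · exact ⟨M True, hM _, ⟨.inl rfl, .inr rfl⟩, fun hM => h hM.2.2⟩
  · exact ⟨M False, hM _, fun i => ⟨i, rfl⟩, fun hM => hM.2⟩

theorem primrecPred_mem_finset {α : Type} [Primcodable α] (s : Finset α) :
    PrimrecPred (· ∈ s) := by
  classical
  induction s using Finset.induction with
  | empty => exact ((Primrec.eq (α := ℕ)).comp (.const 0) (.const 1)).of_eq fun a => by simp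
  | insert a s _ ih =>
    exact ((Primrec.eq.comp .id (.const a)).or ih).of_eq fun b => by simp

/-- With finitely many symbols, validity of a code becomes a lookup in a finite table of symbols and
arities, plus a comparison of two entries for equality. -/
theorem exists_consistent_code_eq_iff {L : FirstOrder.Language.{0, 0}}
    [Encodable (Σ n, L.Relations n)] [Fintype (Σ n, L.Relations n)] (c : LiteralCode) :
    (∃ l : Literal L, l.Consistent ∧ l.code = c) ↔
      (c.2.1 = 0 ∧ c.2.2.length = 2 ∧
        ((c.1 = true ∧ c.2.2[0]? = c.2.2[1]?) ∨ (c.1 = false ∧ ¬ c.2.2[0]? = c.2.2[1]?))) ∨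
      (c.2.1, c.2.2.length) ∈ Finset.univ.image
        fun s : Σ n, L.Relations n => (Encodable.encode s + 1, s.1) := by
  constructor
  · rintro ⟨(⟨a, b⟩ | ⟨R, v⟩) | (⟨a, b⟩ | ⟨R, v⟩), hl, rfl⟩
    · obtain rfl : a = b := hl
      exact .inl ⟨rfl, rfl, .inl ⟨rfl, rfl⟩⟩
    · exact .inr (Finset.mem_image.2 ⟨⟨_, R⟩, Finset.mem_univ _,
        by simp [Literal.code, AtomicSentence.code]⟩)
    · have hab : a ≠ b := hl
      exact .inl ⟨rfl, rfl, .inr ⟨rfl, by simpa [Literal.code, AtomicSentence.code] using hab⟩⟩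
    · exact .inr (Finset.mem_image.2 ⟨⟨_, R⟩, Finset.mem_univ _,
        by simp [Literal.code, AtomicSentence.code]⟩)
  · obtain ⟨s, k, w⟩ := c
    rintro (⟨h₀, h₂, h⟩ | h)
    · obtain ⟨a, b, rfl⟩ := List.length_eq_two.1 h₂
      obtain rfl : k = 0 := h₀
      rcases h with ⟨rfl, h⟩ | ⟨rfl, h⟩
      · exact ⟨.pos (.eq a b), by simpa [Literal.Consistent] using h, rfl⟩
      · exact ⟨.neg (.eq a b), by simpa [Literal.Consistent] using h, rfl⟩
    · obtain ⟨⟨n, R⟩, -, h⟩ := Finset.mem_image.1 h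
      simp only [Prod.mk.injEq] at h
      obtain ⟨rfl, rfl⟩ := h
      cases s
      · exact ⟨.neg (.rel R w.get), trivial, by simp [Literal.code, AtomicSentence.code]⟩
      · exact ⟨.pos (.rel R w.get), trivial, by simp [Literal.code, AtomicSentence.code]⟩

theorem primrecPred_exists_consistent_code_eq {L : FirstOrder.Language.{0, 0}}
    [Encodable (Σ n, L.Relations n)] [Finite (Σ n, L.Relations n)] :
    PrimrecPred fun c : LiteralCode => ∃ l : Literal L, l.Consistent ∧ l.code = c := by
  have := Fintype.ofFinite (Σ n, L.Relations n)
  refine PrimrecPred.of_eq ?_ fun c => (exists_consistent_code_eq_iff c).symm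
  have hk : Primrec fun c : LiteralCode => c.2.1 := Primrec.fst.comp .snd
  have hw : Primrec fun c : LiteralCode => c.2.2 := Primrec.snd.comp .snd
  have hn : Primrec fun c : LiteralCode => c.2.2.length := Primrec.list_length.comp hw
  have hs (b : Bool) : PrimrecPred fun c : LiteralCode => c.1 = b :=
    Primrec.eq.comp .fst (.const b)
  have he : PrimrecPred fun c : LiteralCode => c.2.2[0]? = c.2.2[1]? :=
    Primrec.eq.comp (Primrec.list_getElem?.comp hw (.const 0))
      (Primrec.list_getElem?.comp hw (.const 1))
  exact ((Primrec.eq.comp hk (.const 0)).and ((Primrec.eq.comp hn (.const 2)).and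
    (((hs true).and he).or ((hs false).and he.not)))).or
    ((primrecPred_mem_finset _).comp (hk.pair hn))

/-- The identity operator, restricted to the literals that hold in some structure. -/
def identityOperator (L : FirstOrder.Language.{0, 0}) : Set (Finset (Literal L) × Literal L) :=
  {p | p.1 = {p.2} ∧ p.2.Consistent}

theorem enumOperator_identityOperator {L : FirstOrder.Language.{0, 0}} (A : NatStructure L) :
    enumOperator (identityOperator L) A.diagram = A.diagram := by
  ext l
  constructor
  · rintro ⟨α, hα, hl, -⟩
    exact hα (by simp [show α = {l} from hl])
  · intro h
    exact ⟨{l}, by simpa using h, rfl, Literal.consistent_of_mem_diagram h⟩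

theorem isCE_identityOperator (L : FirstOrder.Language.{0, 0}) [Encodable (Σ n, L.Relations n)]
    [Finite (Σ n, L.Relations n)] : IsCE (identityOperator L) := by
  -- A list presents `{l}` exactly when it is nonempty and all its entries are the code of `l`.
  have hall : PrimrecPred fun p : List LiteralCode × LiteralCode => ∀ c ∈ p.1, c = p.2 :=
    (PrimrecRel.forall_mem_list Primrec.eq)
  have hnil : PrimrecPred fun p : List LiteralCode × LiteralCode => ¬ p.1 = [] :=
    (Primrec.eq.comp .fst (.const [])).not
  have h := hall.and (hnil.and ((primrecPred_exists_consistent_code_eq (L := L)).comp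
    (f := fun p : List LiteralCode × LiteralCode => p.2) .snd))
  refine (ComputablePred.to_re h.computablePred).of_eq ?_
  rintro ⟨w, c⟩
  constructor
  · rintro ⟨h₁, h₂, l, hl, rfl⟩
    refine ⟨{l}, l, ⟨rfl, hl⟩, fun c => ?_, rfl⟩
    obtain ⟨d, hd⟩ := List.exists_mem_of_ne_nil _ h₂
    have := h₁ d hd
    subst this
    simp only [Finset.mem_singleton, exists_eq_left]
    exact ⟨fun hc => (h₁ c hc).symm, fun hc => hc ▸ hd⟩
  · rintro ⟨α, l, ⟨hα, hl⟩, hc, rfl⟩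
    obtain rfl : α = {l} := hα
    simp only [Finset.mem_singleton, exists_eq_left] at hc
    exact ⟨fun c h => ((hc c).1 h).symm, List.ne_nil_of_mem ((hc _).2 rfl), l, hl, rfl⟩

end coding

theorem StructureClass.compEmbeds_of_carrier_subset (K : StructureClass)
    (S : Set (NatStructure K.L))
    (hS : ∀ A B : NatStructure K.L, A.Iso B → A ∈ S → B ∈ S) (h : K.carrier ⊆ S) :
    K.CompEmbeds { K with carrier := S, iso_closed := hS } := by
  have := K.relational
  have := K.finite
  refine ⟨identityOperator K.L, ⟨?_, isCE_identityOperator K.L, ?_⟩, ?_⟩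
  · rintro ⟨α, l⟩ ⟨hα, hl⟩
    obtain ⟨A, hA, hlA⟩ := Literal.Consistent.exists_finite hl
    exact ⟨A, hA, by simpa [show α = {l} from hα] using hlA⟩
  · exact fun A hA => ⟨A, h hA, enumOperator_identityOperator A⟩
  · intro A _ A' _ B _ B' _ hB hB'
    rw [enumOperator_identityOperator] at hB hB'
    have e := NatStructure.iso_of_diagram_eq hB
    have e' := NatStructure.iso_of_diagram_eq hB'
    exact ⟨fun i => e.symm.trans (i.trans e'), fun i => e.trans (i.trans e'.symm)⟩

/-! ### Finite linear orders and prime fields -/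

section finiteClasses

open FirstOrder.Language

theorem FLO_finite (B : NatStructure FirstOrder.Language.order) (hB : B ∈ FLO.carrier) : B.dom.Finite := by
  obtain ⟨M, i, _, ⟨f⟩⟩ := hB
  let := orderStructure (M := M)
  exact Set.finite_coe_iff.1 (Finite.of_equiv M f.symm.toEquiv)

theorem FLO_iso_of_ncard_eq (B : NatStructure FirstOrder.Language.order) (hB : B ∈ FLO.carrier)
    (B' : NatStructure FirstOrder.Language.order) (hB' : B' ∈ FLO.carrier) (h : B.dom.ncard = B'.dom.ncard) :
    B.Iso B' := by
  obtain ⟨M, i, hM, ⟨f⟩⟩ := hB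
  obtain ⟨M', i', hM', ⟨f'⟩⟩ := hB'
  let := orderStructure (M := M)
  let := orderStructure (M := M')
  have := Fintype.ofFinite M
  have := Fintype.ofFinite M'
  have hc : Fintype.card M = Fintype.card M' := by
    rw [← Nat.card_eq_fintype_card, ← Nat.card_eq_fintype_card, ← Nat.card_congr f.toEquiv,
      ← Nat.card_congr f'.toEquiv]
    exact h
  let g : M ≃o M' := (Fintype.orderIsoFinOfCardEq M hc).symm.trans
    (Fintype.orderIsoFinOfCardEq M' rfl)
  let e : M ≃[FirstOrder.Language.order] M' := ⟨g.toEquiv, fun f => f.elim, fun R v => by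
    cases R
    exact g.le_iff_le (x := v 0) (y := v 1)⟩
  exact ⟨f'.symm.comp (e.comp f)⟩

theorem PF_finite (B : NatStructure fieldLang) (hB : B ∈ PF.carrier) : B.dom.Finite := by
  obtain ⟨p, _, ⟨f⟩⟩ := hB
  let := fieldStructure (ZMod p)
  exact Set.finite_coe_iff.1 (Finite.of_equiv (ZMod p) f.symm.toEquiv)

theorem PF_iso_of_ncard_eq (B : NatStructure fieldLang) (hB : B ∈ PF.carrier)
    (B' : NatStructure fieldLang) (hB' : B' ∈ PF.carrier) (h : B.dom.ncard = B'.dom.ncard) :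
    B.Iso B' := by
  obtain ⟨p, _, ⟨f⟩⟩ := hB
  let := fieldStructure (ZMod p)
  obtain ⟨q, _, ⟨g⟩⟩ := hB'
  let := fieldStructure (ZMod q)
  have hpq : p = q := by
    rw [← Nat.card_zmod p, ← Nat.card_zmod q, ← Nat.card_congr f.toEquiv,
      ← Nat.card_congr g.toEquiv]
    exact h
  subst hpq
  exact ⟨g.symm.comp f⟩

theorem exists_seq_FLO : ∃ X : ℕ → NatStructure FirstOrder.Language.order, (∀ n, X n ∈ FLO.carrier) ∧
    ∀ m n, (X m).Iso (X n) → m = n := by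
  have h : ∀ n, ∃ A ∈ FLO.carrier, A.dom.ncard = n := by
    intro n
    let := orderStructure (M := Fin n)
    obtain ⟨A, e, -⟩ := exists_natStructure (L := FirstOrder.Language.order) (M := Fin n) _ Fin.val_injective
    refine ⟨A, ⟨Fin n, inferInstance, inferInstance, ⟨e.symm⟩⟩, ?_⟩
    exact (Nat.card_congr e.toEquiv).symm.trans (Nat.card_fin n)
  choose X hX hn using h
  exact ⟨X, hX, fun m n e => by rw [← hn m, ← hn n, e.ncard_dom_eq]⟩

theorem exists_seq_PF : ∃ X : ℕ → NatStructure fieldLang, (∀ n, X n ∈ PF.carrier) ∧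
    ∀ m n, (X m).Iso (X n) → m = n := by
  have h : ∀ n, ∃ A ∈ PF.carrier, A.dom.ncard = Nat.nth Nat.Prime n := by
    intro n
    have hp : Fact (Nat.nth Nat.Prime n).Prime := ⟨Nat.prime_nth_prime n⟩
    let := fieldStructure (ZMod (Nat.nth Nat.Prime n))
    obtain ⟨A, e, -⟩ := exists_natStructure (L := fieldLang)
      (M := ZMod (Nat.nth Nat.Prime n)) _ (ZMod.val_injective _)
    refine ⟨A, ⟨_, hp, ⟨e.symm⟩⟩, ?_⟩
    exact (Nat.card_congr e.toEquiv).symm.trans (Nat.card_zmod _)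
  choose X hX hn using h
  exact ⟨X, hX, fun m n e => Nat.nth_injective Nat.infinite_setOfPred_prime
    (by rw [← hn m, ← hn n, e.ncard_dom_eq])⟩

end finiteClasses

/-! ### Vector spaces -/

section vectorSpaces

open FirstOrder.Language.Structure

/-- The relations on vectors say that `x`, `x + y - z` or `q • x - y` vanishes, so `g` has to detect
vanishing only for these expressions over `S`. This covers both linear isomorphisms and
non-injective maps on finite sets. -/
theorem vectLang_relMap_sumMap {V W : Type} [AddCommGroup V] [Module ℚ V] [AddCommGroup W]
    [Module ℚ W] (g : V →ₗ[ℚ] W) (S : Set (ℚ ⊕ V))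
    (hS₁ : ∀ x, .inr x ∈ S → g x = 0 → x = 0)
    (hS₂ : ∀ x y z, .inr x ∈ S → .inr y ∈ S → .inr z ∈ S → g (x + y - z) = 0 → x + y - z = 0)
    (hS₃ : ∀ q x y, .inl q ∈ S → .inr x ∈ S → .inr y ∈ S → g (q • x - y) = 0 → q • x - y = 0)
    {n : ℕ} (R : vectLang.Relations n) (v : Fin n → ℚ ⊕ V) (hv : ∀ i, v i ∈ S) :
    letI := vectStructure V
    letI := vectStructure W
    RelMap R (Sum.map id g ∘ v) ↔ RelMap R v := by
  have h₁ : ∀ x, .inr x ∈ S → (g x = 0 ↔ x = 0) :=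
    fun x hx => ⟨hS₁ x hx, fun h => by rw [h, map_zero]⟩
  have h₂ : ∀ x y z, .inr x ∈ S → .inr y ∈ S → .inr z ∈ S →
      (g z = g x + g y ↔ z = x + y) := fun x y z hx hy hz =>
    ⟨fun h => (sub_eq_zero.1 (hS₂ x y z hx hy hz (by simp [h]))).symm, fun h => by simp [h]⟩
  have h₃ : ∀ q x y, .inl q ∈ S → .inr x ∈ S → .inr y ∈ S →
      (g y = q • g x ↔ y = q • x) := fun q x y hq hx hy =>
    ⟨fun h => (sub_eq_zero.1 (hS₃ q x y hq hx hy (by simp [h]))).symm, fun h => by simp [h]⟩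
  let m : ℚ ⊕ V → ℚ ⊕ W := Sum.map id g
  rcases R with _ | _ | _ | _ | _ | _ | _ | _ | _
  · change (∃ x, m (v 0) = .inr x) ↔ ∃ x, v 0 = .inr x
    rcases v 0 with q | x <;> simp [m]
  · change (∃ q, m (v 0) = .inl q) ↔ ∃ q, v 0 = .inl q
    rcases v 0 with q | x <;> simp [m]
  · change m (v 0) = .inl 0 ↔ v 0 = .inl 0
    rcases v 0 with q | x <;> simp [m]
  · change m (v 0) = .inl 1 ↔ v 0 = .inl 1
    rcases v 0 with q | x <;> simp [m]
  · change (∃ q r, m (v 0) = .inl q ∧ m (v 1) = .inl r ∧ m (v 2) = .inl (q + r)) ↔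
      ∃ q r, v 0 = .inl q ∧ v 1 = .inl r ∧ v 2 = .inl (q + r)
    rcases v 0 with q | x <;> rcases v 1 with r | y <;> rcases v 2 with s | z <;> simp [m]
  · change (∃ q r, m (v 0) = .inl q ∧ m (v 1) = .inl r ∧ m (v 2) = .inl (q * r)) ↔
      ∃ q r, v 0 = .inl q ∧ v 1 = .inl r ∧ v 2 = .inl (q * r)
    rcases v 0 with q | x <;> rcases v 1 with r | y <;> rcases v 2 with s | z <;> simp [m]
  · change m (v 0) = .inr 0 ↔ v 0 = .inr 0
    have hv₀ := hv 0
    generalize v 0 = a at *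
    rcases a with q | x
    · simp [m]
    · simpa [m] using h₁ x hv₀
  · change (∃ x y, m (v 0) = .inr x ∧ m (v 1) = .inr y ∧ m (v 2) = .inr (x + y)) ↔
      ∃ x y, v 0 = .inr x ∧ v 1 = .inr y ∧ v 2 = .inr (x + y)
    have hv₀ := hv 0
    have hv₁ := hv 1
    have hv₂ := hv 2
    generalize v 0 = a at *
    generalize v 1 = b at *
    generalize v 2 = c at *
    rcases a with q | x <;> rcases b with r | y <;> rcases c with s | z
    case inr.inr.inr => simpa [m] using h₂ x y z hv₀ hv₁ hv₂
    all_goals simp [m]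
  · change (∃ q x, m (v 0) = .inl q ∧ m (v 1) = .inr x ∧ m (v 2) = .inr (q • x)) ↔
      ∃ q x, v 0 = .inl q ∧ v 1 = .inr x ∧ v 2 = .inr (q • x)
    have hv₀ := hv 0
    have hv₁ := hv 1
    have hv₂ := hv 2
    generalize v 0 = a at *
    generalize v 1 = b at *
    generalize v 2 = c at *
    rcases a with q | x <;> rcases b with r | y <;> rcases c with s | z
    case inl.inr.inr => simpa [m] using h₃ q y z hv₀ hv₁ hv₂
    all_goals simp [m]

theorem nonempty_vectLang_equiv_iff (V W : Type) [AddCommGroup V] [Module ℚ V] [AddCommGroup W]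
    [Module ℚ W] [FiniteDimensional ℚ V] [FiniteDimensional ℚ W] :
    letI := vectStructure V
    letI := vectStructure W
    Nonempty ((ℚ ⊕ V) ≃[vectLang] (ℚ ⊕ W)) ↔ Module.finrank ℚ V = Module.finrank ℚ W := by
  let := vectStructure V
  let := vectStructure W
  constructor
  · rintro ⟨e⟩
    have hvec (e : (ℚ ⊕ V) ≃[vectLang] (ℚ ⊕ W)) (x : V) : ∃ y : W, e (.inr x) = .inr y :=
      (e.map_rel VectRel.vector ![.inr x]).2 ⟨x, rfl⟩
    have hvec' (y : W) : ∃ x : V, e.symm (.inr y) = .inr x :=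
      (e.symm.map_rel VectRel.vector ![.inr y]).2 ⟨y, rfl⟩
    choose f hf using hvec e
    choose g hg using hvec'
    have hadd (x y : V) : f (x + y) = f x + f y := by
      obtain ⟨a, b, ha, hb, hab⟩ :=
        (e.map_rel VectRel.addV ![.inr x, .inr y, .inr (x + y)]).2 ⟨x, y, rfl, rfl, rfl⟩
      have ha' := (hf x).symm.trans ha
      have hb' := (hf y).symm.trans hb
      have hab' := (hf (x + y)).symm.trans hab
      rw [Sum.inr.injEq] at ha' hb' hab'
      rw [hab', ha', hb']
    let F : V ≃+ W :=
      { toFun := f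
        invFun := g
        left_inv := fun x => Sum.inr_injective (β := V) (α := ℚ)
          (by rw [← hg, ← hf, e.symm_apply_apply])
        right_inv := fun y => Sum.inr_injective (β := W) (α := ℚ)
          (by rw [← hf, ← hg, e.apply_symm_apply])
        map_add' := hadd }
    -- Additive maps between `ℚ`-spaces are linear, so the action of `e` on scalars plays no role.
    exact (F.toLinearEquiv fun q x => map_rat_smul F q x).finrank_eq
  · intro h
    let l : V ≃ₗ[ℚ] W := LinearEquiv.ofFinrankEq _ _ h
    refine ⟨⟨Equiv.sumCongr (Equiv.refl ℚ) l.toEquiv, fun f => f.elim, fun R v => ?_⟩⟩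
    have hl : ∀ x, l x = 0 → x = 0 := fun x => l.map_eq_zero_iff.1
    exact vectLang_relMap_sumMap l.toLinearMap Set.univ (fun x _ => hl x)
      (fun x y z _ _ _ => hl _) (fun q x y _ _ _ => hl _) R v fun _ => Set.mem_univ _

/-- A line suffices: some functional `φ` on `V` is nonzero at any given finitely many nonzero
vectors, and `x ↦ φ x • w` then respects every relation in a finite piece. -/
theorem nonempty_vectLang_embedding (V W : Type) [AddCommGroup V] [Module ℚ V] [AddCommGroup W]
    [Module ℚ W] [Nontrivial W] (C : NatStructure vectLang) (hC : C.dom.Finite)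
    (f : letI := vectStructure V; C.dom ↪[vectLang] (ℚ ⊕ V)) :
    letI := vectStructure W
    Nonempty (C.dom ↪[vectLang] (ℚ ⊕ W)) := by
  let := vectStructure V
  let := vectStructure W
  obtain ⟨w, hw⟩ := exists_ne (0 : W)
  have : Finite C.dom := hC
  let S : Set (ℚ ⊕ V) := Set.range f
  have hS : S.Finite := Set.finite_range f
  let SQ : Set ℚ := Sum.inl ⁻¹' S
  let SV : Set V := Sum.inr ⁻¹' S
  have hSQ : SQ.Finite := hS.preimage Sum.inl_injective.injOn
  have hSV : SV.Finite := hS.preimage Sum.inr_injective.injOn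
  -- The four parts serve the zero vector, injectivity, addition and scalar multiplication.
  let T : Set V := SV ∪ ((fun p : V × V => p.1 - p.2) '' (SV ×ˢ SV) ∪
    ((fun p : V × V × V => p.1 + p.2.1 - p.2.2) '' (SV ×ˢ SV ×ˢ SV) ∪
    (fun p : ℚ × V × V => p.1 • p.2.1 - p.2.2) '' (SQ ×ˢ SV ×ˢ SV)))
  have hT : T.Finite := hSV.union (((hSV.prod hSV).image _).union
    (((hSV.prod (hSV.prod hSV)).image _).union ((hSQ.prod (hSV.prod hSV)).image _)))
  have : Finite {x // x ∈ T ∧ x ≠ 0} := hT.subset fun x hx => hx.1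
  obtain ⟨φ, hφ⟩ := Module.exists_dual_forall_apply_ne_zero (K := ℚ)
    (fun x : {x // x ∈ T ∧ x ≠ 0} => (x : V)) fun x => x.2.2
  let g : V →ₗ[ℚ] W := φ.smulRight w
  have hg : ∀ x ∈ T, g x = 0 → x = 0 := by
    intro x hx h
    by_contra h₀
    refine hφ ⟨x, hx, h₀⟩ ?_
    simpa [g, hw] using h
  refine ⟨⟨⟨Sum.map id g ∘ f, ?_⟩, fun f => f.elim, fun R v => ?_⟩⟩
  · intro a b h
    refine f.injective ?_
    have ha : f a ∈ S := ⟨a, rfl⟩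
    have hb : f b ∈ S := ⟨b, rfl⟩
    simp only [Function.comp_apply] at h
    generalize f a = x at *
    generalize f b = y at *
    rcases x with q | x <;> rcases y with r | y
    · simpa using h
    · simp at h
    · simp at h
    · have h' : g (x - y) = 0 := by simpa [sub_eq_zero] using h
      have := hg (x - y) (.inr (.inl ⟨(x, y), ⟨ha, hb⟩, rfl⟩)) h'
      rw [sub_eq_zero.1 this]
  · refine (vectLang_relMap_sumMap g S (fun x hx => hg x (.inl hx))
      (fun x y z hx hy hz => hg _ (.inr (.inr (.inl ⟨(x, y, z), ⟨hx, hy, hz⟩, rfl⟩))))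
      (fun q x y hq hx hy => hg _ (.inr (.inr (.inr ⟨(q, x, y), ⟨hq, hx, hy⟩, rfl⟩))))
      R (f ∘ v) fun i => ⟨v i, rfl⟩).trans (f.map_rel R v)

end vectorSpaces

/-! ### Dimension as the isomorphism invariant, and the two obstructions to embeddings -/

section dimension

theorem vectClass_mono {S T : Set ℕ} (h : S ⊆ T) :
    (vectClass S).carrier ⊆ (vectClass T).carrier :=
  fun _ ⟨W, i, j, hW, hS, e⟩ => ⟨W, i, j, hW, h hS, e⟩

theorem exists_mem_vectClass_singleton {S : Set ℕ} {A : NatStructure vectLang}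
    (hA : A ∈ (vectClass S).carrier) : ∃ n ∈ S, A ∈ (vectClass {n}).carrier := by
  obtain ⟨W, i, j, hW, hS, e⟩ := hA
  exact ⟨_, hS, W, i, j, hW, rfl, e⟩

theorem iso_iff_of_mem_vectClass {m n : ℕ} {A B : NatStructure vectLang}
    (hA : A ∈ (vectClass {m}).carrier) (hB : B ∈ (vectClass {n}).carrier) :
    A.Iso B ↔ m = n := by
  obtain ⟨V, i, j, hV, hm, ⟨e⟩⟩ := hA
  obtain ⟨W, i', j', hW, hn, ⟨f⟩⟩ := hB
  rw [Set.mem_singleton_iff] at hm hn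
  subst hm hn
  let := vectStructure V
  let := vectStructure W
  rw [← nonempty_vectLang_equiv_iff V W]
  exact ⟨fun ⟨g⟩ => ⟨f.comp (g.comp e.symm)⟩, fun ⟨g⟩ => ⟨f.symm.comp (g.comp e)⟩⟩

theorem exists_mem_vectClass (n : ℕ) : ∃ A, A ∈ (vectClass {n}).carrier := by
  let := vectStructure (Fin n → ℚ)
  obtain ⟨c, hc⟩ := Countable.exists_injective_nat (ℚ ⊕ (Fin n → ℚ))
  obtain ⟨A, e, -⟩ := exists_natStructure (L := vectLang) c hc
  exact ⟨A, Fin n → ℚ, inferInstance, inferInstance, inferInstance, by simp, ⟨e.symm⟩⟩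

instance : vectLang.IsRelational := fun _ => inferInstanceAs (IsEmpty Empty)

theorem locallyIn_of_mem_vectClass {m n : ℕ} (hn : n ≠ 0) {A B : NatStructure vectLang}
    (hA : A ∈ (vectClass {m}).carrier) (hB : B ∈ (vectClass {n}).carrier) :
    StructureClass.LocallyIn A B := by
  intro F hF
  obtain ⟨V, i, j, hV, hm, ⟨e⟩⟩ := hA
  obtain ⟨W, i', j', hW, rfl, ⟨f⟩⟩ := hB
  let := vectStructure V
  let := vectStructure W
  have : Nontrivial W := Module.nontrivial_of_finrank_pos (R := ℚ) (Nat.pos_of_ne_zero hn)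
  have hfin : (A.restrict F).dom.Finite := hF.subset Set.inter_subset_right
  obtain ⟨g⟩ := nonempty_vectLang_embedding V W (A.restrict F) hfin
    (e.toEmbedding.comp (A.restrictEmbedding F))
  have : Countable (ℚ ⊕ W) := f.toEquiv.symm.injective.countable
  obtain ⟨C, ⟨h⟩, hC⟩ := (A.restrict F).exists_diagram_subset_of_embedding hfin g
  exact ⟨C, ⟨f.symm.comp h⟩, hC⟩

/-- The dimension of the vector space which the enumeration operator assigns to `A`. -/
noncomputable def imageDim {L : FirstOrder.Language.{0, 0}}
    (Φ : Set (Finset (Literal L) × Literal vectLang)) (A : NatStructure L) : ℕ :=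
  sInf {n | ∃ B ∈ (vectClass {n}).carrier, enumOperator Φ A.diagram = B.diagram}

theorem imageDim_eq {L : FirstOrder.Language.{0, 0}}
    {Φ : Set (Finset (Literal L) × Literal vectLang)} {A : NatStructure L} {n : ℕ}
    {B : NatStructure vectLang} (hB : B ∈ (vectClass {n}).carrier)
    (h : enumOperator Φ A.diagram = B.diagram) : imageDim Φ A = n := by
  -- The diagram fixes the space up to isomorphism, so the infimum is over a singleton.
  have : {n | ∃ B ∈ (vectClass {n}).carrier, enumOperator Φ A.diagram = B.diagram} = {n} := by
    ext m
    constructor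
    · rintro ⟨C, hC, h'⟩
      exact (iso_iff_of_mem_vectClass hC hB).1
        (NatStructure.iso_of_diagram_eq (h'.symm.trans h))
    · rintro rfl
      exact ⟨B, hB, h⟩
  rw [imageDim, this, csInf_singleton]

/-- The functions giving the dimensions of the images of the members of the sequence `X`. -/
def imageDimFunctions (K : StructureClass) (X : ℕ → NatStructure K.L) : Set (ℕ → ℕ) :=
  (fun Φ n => imageDim Φ (X n)) '' {Φ | @IsCE K.L vectLang K.enc FVS.enc Φ}

theorem countable_imageDimFunctions (K : StructureClass) (X : ℕ → NatStructure K.L) :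
    (imageDimFunctions K X).Countable :=
  (@countable_setOf_isCE K.L vectLang K.enc FVS.enc).image _

/-- An embedding makes the dimension function injective on `J`, so its range is infinite and `hS`
applies. Its values outside `J`, where `X j` need not be in `K`, are irrelevant. -/
theorem not_compEmbeds_vectClass (K : StructureClass) (X : ℕ → NatStructure K.L) (S J : Set ℕ)
    (hJ : J.Infinite) (hX : ∀ j ∈ J, X j ∈ K.carrier)
    (hinj : ∀ i ∈ J, ∀ j ∈ J, (X i).Iso (X j) → i = j)
    (hS : ∀ h ∈ imageDimFunctions K X, (Set.range h).Infinite → ∃ j ∈ J, h j ∉ S) :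
    ¬ K.CompEmbeds (vectClass S) := by
  rintro ⟨Φ, hΦ⟩
  have key : ∀ j ∈ J, ∃ B ∈ (vectClass S).carrier, enumOperator Φ (X j).diagram = B.diagram ∧
      imageDim Φ (X j) ∈ S ∧ B ∈ (vectClass {imageDim Φ (X j)}).carrier := by
    intro j hj
    obtain ⟨B, hB, h⟩ := hΦ.1.2.2 _ (hX j hj)
    obtain ⟨n, hn, hBn⟩ := exists_mem_vectClass_singleton hB
    obtain rfl := imageDim_eq hBn h
    exact ⟨B, hB, h, hn, hBn⟩
  have hinjOn : Set.InjOn (fun n => imageDim Φ (X n)) J := by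
    intro i hi j hj hij
    obtain ⟨B, hB, h, -, hBn⟩ := key i hi
    obtain ⟨B', hB', h', -, hBn'⟩ := key j hj
    exact hinj i hi j hj ((hΦ.2 _ (hX i hi) _ (hX j hj) B hB B' hB' h h').2
      ((iso_iff_of_mem_vectClass hBn hBn').2 hij))
  obtain ⟨j, hj, hjS⟩ := hS _ ⟨Φ, hΦ.1.2.1, rfl⟩
    ((hJ.image hinjOn).mono (Set.image_subset_range _ _))
  obtain ⟨-, -, -, h, -⟩ := key j hj
  exact hjS h

theorem vectClass_not_compEmbeds (S : Set ℕ) (hS : S.Infinite) (K : StructureClass)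
    (hfin : ∀ B ∈ K.carrier, B.dom.Finite)
    (hcard : ∀ B ∈ K.carrier, ∀ B' ∈ K.carrier, B.dom.ncard = B'.dom.ncard → B.Iso B') :
    ¬ (vectClass S).CompEmbeds K := by
  intro h
  -- Both dimensions must be positive: the zero space has no room for pieces of the others.
  obtain ⟨m, hm, hm₀⟩ := hS.exists_gt 0
  obtain ⟨n, hn, hmn⟩ := hS.exists_gt m
  obtain ⟨A, hA⟩ := exists_mem_vectClass m
  obtain ⟨B, hB⟩ := exists_mem_vectClass n
  have : (vectClass S).L.IsRelational := (vectClass S).relational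
  have hAB := h.iso_of_locallyIn hfin hcard
    (vectClass_mono (Set.singleton_subset_iff.2 hm) hA)
    (vectClass_mono (Set.singleton_subset_iff.2 hn) hB)
    (locallyIn_of_mem_vectClass (hm₀.trans hmn).ne' hA hB)
    (locallyIn_of_mem_vectClass hm₀.ne' hB hA)
  exact hmn.ne ((iso_iff_of_mem_vectClass hA hB).1 hAB)

end dimension

theorem proposition4p7 :
    ∃ A : (ℕ → Bool) → Set ℕ,
      (∀ f g : ℕ → Bool, f ≠ g → Delta03BiImmune (A f) (A g)) ∧
      (∀ f : ℕ → Bool,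
        (vectClass (A f)).CompEmbeds FVS ∧
        (vectClass (A f)).Incomparable PF ∧
        (vectClass (A f)).Incomparable FLO) ∧
      (∀ f g : ℕ → Bool, f ≠ g →
        (vectClass (A f)).Incomparable (vectClass (A g))) := by
  choose V hV using exists_mem_vectClass
  obtain ⟨P, hP, hP'⟩ := exists_seq_PF
  obtain ⟨O, hO, hO'⟩ := exists_seq_FLO
  obtain ⟨A, hA, hH⟩ := exists_family_avoiding
    ({f | IsDelta03Fun f} ∪ (imageDimFunctions FVS V ∪
      (imageDimFunctions PF P ∪ imageDimFunctions FLO O)))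
    (countable_setOf_isDelta03Fun.union ((countable_imageDimFunctions _ _).union
      ((countable_imageDimFunctions _ _).union (countable_imageDimFunctions _ _))))
  -- For `PF` and `FLO` any infinite index set `J` may be used; `A` at the complement of `f` is one
  -- on which every function in the family leaves `A f`.
  have hne : ∀ f : ℕ → Bool, (fun n => !f n) ≠ f := fun f h => by
    simpa using congrFun h 0
  -- All the classes `vectClass S` share their language and coding, so the functions obtained from
  -- `FVS` serve every source `vectClass (A f)`.
  have hvect : ∀ f g, f ≠ g → ¬ (vectClass (A f)).CompEmbeds (vectClass (A g)) := fun f g hfg =>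
    not_compEmbeds_vectClass (vectClass (A f)) V (A g) (A f) (hA f)
      (fun j hj => vectClass_mono (Set.singleton_subset_iff.2 hj) (hV j))
      (fun i _ j _ h => (iso_iff_of_mem_vectClass (hV i) (hV j)).1 h)
      fun h hh => hH f g hfg h (.inr (.inl hh))
  refine ⟨A, ?_, ?_, ?_⟩
  · exact fun f g hfg h hh hr =>
      ⟨hH f g hfg h (.inl hh) hr, hH g f hfg.symm h (.inl hh) hr⟩
  · refine fun f => ⟨?_, ⟨?_, ?_⟩, ⟨?_, ?_⟩⟩
    · exact StructureClass.compEmbeds_of_carrier_subset (vectClass (A f)) FVS.carrier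
        FVS.iso_closed (vectClass_mono (Set.subset_univ _))
    · exact vectClass_not_compEmbeds _ (hA f) PF PF_finite PF_iso_of_ncard_eq
    · exact not_compEmbeds_vectClass PF P (A f) _ (hA fun n => !f n) (fun j _ => hP j)
        (fun i _ j _ h => hP' i j h) fun h hh => hH _ f (hne f) h (.inr (.inr (.inl hh)))
    · exact vectClass_not_compEmbeds _ (hA f) FLO FLO_finite FLO_iso_of_ncard_eq
    · exact not_compEmbeds_vectClass FLO O (A f) _ (hA fun n => !f n) (fun j _ => hO j)
        (fun i _ j _ h => hO' i j h) fun h hh => hH _ f (hne f) h (.inr (.inr (.inr hh)))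
  · exact fun f g hfg => ⟨hvect f g hfg, hvect g f hfg.symm⟩
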